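/- All topological groups are Hausdorff. A topological space $X$ is called \emph{maximal} if it has no isolated points, but every strictly stronger topology on $X$ has an isolated point; a topological group is maximal if its underlying space is maximal. A subset $S$ of a topological group $G$ with identity $e$ is a \emph{suitable set} for $G$ if $S$ is discrete in the subspace topology, $S\cup\{e\}$ is closed in $G$, and the subgroup $\langle S\rangle$ generated by $S$ is dense in $G$; a \emph{closed suitable set} is a suitable set that is itself closed in $G$. A group is \emph{Boolean} if $h^2=e$ for all of its elements $h$. \textbf{Theorem.} Every maximal topological group $G$ has a closed suitable set. More precisely, $G$ has an open countable Boolean subgroup $H$ such that $H$ (with the subspace topology) has a closed suitable set, and such that, for every closed suitable set $S$ for $H$ and every set $A\subseteq G\setminus H$ containing exactly one point of each left coset of $H$ in $G\setminus H$, the set $A\cup S$ is a closed suitable set for $G$. -/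

import Mathlib

/-- A topological space is maximal if it has no isolated points, but every strictly stronger
topology on the same set has one. (In Mathlib's order `t' < t` means that `t'` is strictly finer.) -/
def IsMaximalSpace (X : Type*) [t : TopologicalSpace X] : Prop :=
  (∀ x : X, ¬ IsOpen ({x} : Set X)) ∧
    ∀ t' : TopologicalSpace X, t' < t → ∃ x : X, @IsOpen X t' {x}

/-- `S` is a suitable set for `G`: it is a discrete subspace, `S ∪ {e}` is closed, and the subgroup
generated by `S` is dense. -/
structure IsSuitableSet {G : Type*} [Group G] [TopologicalSpace G] (S : Set G) : Prop where
  discrete : DiscreteTopology S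
  isClosed_union_one : IsClosed (S ∪ {1})
  dense : Dense (Subgroup.closure S : Set G)

/-- A closed suitable set: a suitable set that is itself a closed subset of the group. -/
structure IsClosedSuitableSet {G : Type*} [Group G] [TopologicalSpace G] (S : Set G) : Prop where
  isSuitable : IsSuitableSet S
  isClosed : IsClosed S

/-- A subgroup is Boolean if all its elements satisfy `h * h = e`. -/
def IsBooleanSubgroup {G : Type*} [Group G] (H : Subgroup G) : Prop :=
  ∀ h ∈ H, h * h = 1

/-- `A` consists of exactly one point from each left coset of `H` contained in `G \ H`. -/
def SelectsOutsideCosets {G : Type*} [Group G] (H : Subgroup G) (A : Set G) : Prop :=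
  (∀ a ∈ A, a ∉ H) ∧ ∀ g : G, g ∉ H → ∃! a, a ∈ A ∧ a⁻¹ * g ∈ H

open Filter Topology Set
open scoped Pointwise

/-! In a maximal space every preperfect set is open, so dense sets are open and closures of open
sets are open. Extremal disconnectedness makes the fixed points of inversion open, which gives an
open Boolean subgroup. Its elements can be coded as finite sets under symmetric difference. If every
neighbourhood of the identity were uncountable, sunflowers would split the subgroup into two
disjoint dense sets, which is impossible when dense sets are open; hence a countable open subgroup
`H`. In a maximal Boolean group the singletons of the coding have empty interior, so all their
subsets are closed and they form a closed discrete generating set. Coset representatives extend such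
sets from `H` to `G`. -/

/-! ### Maximal spaces -/

theorem IsMaximalSpace.perfectSpace {X : Type*} [TopologicalSpace X] (h : IsMaximalSpace X) :
    PerfectSpace X :=
  perfectSpace_iff_forall_not_isolated.2 fun x =>
    ⟨fun hx => h.1 x ((isOpen_singleton_iff_punctured_nhds x).2 hx)⟩

/-- The coarsest topology refining a given one in which `A` is open. -/
abbrev TopologicalSpace.adjoin {X : Type*} (t : TopologicalSpace X) (A : Set X) :
    TopologicalSpace X where
  IsOpen W := ∃ U V : Set X, IsOpen U ∧ IsOpen V ∧ W = U ∪ V ∩ A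
  isOpen_univ := ⟨univ, univ, isOpen_univ, isOpen_univ, by simp⟩
  isOpen_inter := by
    rintro _ _ ⟨U, V, hU, hV, rfl⟩ ⟨U', V', hU', hV', rfl⟩
    refine ⟨U ∩ U', U ∩ V' ∪ V ∩ U' ∪ V ∩ V', hU.inter hU',
      ((hU.inter hV').union (hV.inter hU')).union (hV.inter hV'), ?_⟩
    ext x
    simp only [mem_inter_iff, mem_union]
    tauto
  isOpen_sUnion := by
    intro s hs
    choose! U V hU hV hUV using hs
    refine ⟨⋃ w ∈ s, U w, ⋃ w ∈ s, V w, isOpen_biUnion hU, isOpen_biUnion hV, ?_⟩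
    simp_rw [iUnion₂_inter, ← iUnion_union_distrib]
    rw [sUnion_eq_biUnion]
    exact iUnion₂_congr hUV

/-- Adjoining `A` to the topology creates no isolated point: such a point would be isolated in `X`
or in `A`. -/
theorem IsMaximalSpace.isOpen_of_preperfect {X : Type*} [t : TopologicalSpace X]
    (h : IsMaximalSpace X) {A : Set X} (hA : Preperfect A) : IsOpen A := by
  by_contra hno
  have hle : t.adjoin A ≤ t := fun U hU => ⟨U, ∅, hU, isOpen_empty, by simp⟩
  have hlt : t.adjoin A < t := lt_of_le_not_ge hle fun hge =>
    hno (hge A ⟨∅, univ, isOpen_empty, isOpen_univ, by simp⟩)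
  obtain ⟨x, U, V, hU, hV, hx⟩ := h.2 _ hlt
  have hxm : x ∈ U ∪ V ∩ A := hx ▸ mem_singleton x
  rcases hxm with hxU | ⟨hxV, hxA⟩
  · refine h.1 x ?_
    have : U = {x} := Subset.antisymm (hx ▸ subset_union_left) (singleton_subset_iff.2 hxU)
    exact this ▸ hU
  · obtain ⟨y, ⟨hyV, hyA⟩, hyx⟩ := preperfect_iff_nhds.1 hA x hxA V (hV.mem_nhds hxV)
    have : y ∈ ({x} : Set X) := hx ▸ Or.inr ⟨hyV, hyA⟩
    exact hyx this

/-- Every open set of a finer topology without isolated points is preperfect in the original one. -/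
theorem isMaximalSpace_of_isOpen_of_preperfect {X : Type*} [t : TopologicalSpace X]
    (h1 : ∀ x : X, ¬ IsOpen ({x} : Set X)) (h2 : ∀ A : Set X, Preperfect A → IsOpen A) :
    IsMaximalSpace X := by
  have h3 : ∀ A : Set X, (∀ x ∈ A, ∀ V, IsOpen V → {x} ≠ V ∩ A) → IsOpen A := by
    refine fun A hA => h2 A (preperfect_iff_nhds.2 fun x hx U hU => ?_)
    obtain ⟨V, hVU, hV, hxV⟩ := mem_nhds_iff.1 hU
    by_contra! hcon
    exact hA x hx V hV (Subset.antisymm (singleton_subset_iff.2 ⟨hxV, hx⟩)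
      fun y hy => hcon y ⟨hVU hy.1, hy.2⟩)
  refine ⟨h1, fun t' hlt => ?_⟩
  by_contra! hno
  refine hlt.not_ge fun A hA => h3 A fun x hx V hV hxV => hno x ?_
  rw [hxV]
  exact t'.isOpen_inter V A (hlt.le V hV) hA

theorem IsMaximalSpace.subtype {X : Type*} [TopologicalSpace X] (h : IsMaximalSpace X)
    {Y : Set X} (hY : IsOpen Y) : IsMaximalSpace Y := by
  refine isMaximalSpace_of_isOpen_of_preperfect (fun y hy => ?_) fun A hA => ?_
  · refine h.1 y ?_
    simpa using hY.isOpenMap_subtype_val _ hy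
  · rw [← preimage_image_eq A Subtype.val_injective]
    refine (h.isOpen_of_preperfect (preperfect_iff_nhds.2 ?_)).preimage continuous_subtype_val
    rintro _ ⟨x, hx, rfl⟩ U hU
    obtain ⟨y, ⟨hyU, hyA⟩, hyx⟩ := preperfect_iff_nhds.1 hA x hx (Subtype.val ⁻¹' U)
      (continuous_subtype_val.continuousAt hU)
    exact ⟨y, ⟨hyU, y, hyA, rfl⟩, fun h => hyx (Subtype.ext h)⟩

theorem IsMaximalSpace.isOpen_of_dense {X : Type*} [TopologicalSpace X] [T1Space X]
    (h : IsMaximalSpace X) {D : Set X} (hD : Dense D) : IsOpen D := by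
  have := h.perfectSpace
  refine h.isOpen_of_preperfect (preperfect_iff_perfect_closure.2 ?_)
  rw [hD.closure_eq]
  exact PerfectSpace.univ_perfect X

theorem IsMaximalSpace.extremallyDisconnected {X : Type*} [TopologicalSpace X]
    (h : IsMaximalSpace X) : ExtremallyDisconnected X := by
  have := h.perfectSpace
  exact ⟨fun U hU => h.isOpen_of_preperfect hU.preperfect.perfect_closure.acc⟩

/-! ### Involutions and an open Boolean subgroup -/

/-- In an extremally disconnected Hausdorff space the fixed points of a continuous involution form
an open set. -/
theorem ExtremallyDisconnected.isOpen_fixedPoints {X : Type*} [TopologicalSpace X] [T2Space X]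
    [ExtremallyDisconnected X] {f : X → X} (hf : Continuous f) (hff : Function.Involutive f) :
    IsOpen {x | f x = x} := by
  obtain ⟨D, hD⟩ := zorn_subset {U : Set X | IsOpen U ∧ Disjoint U (f ⁻¹' U)} <| by
    refine fun c hc hchain => ⟨⋃₀ c, ⟨isOpen_sUnion fun U hU => (hc hU).1, ?_⟩,
      fun U hU => subset_sUnion_of_mem hU⟩
    rw [Set.disjoint_left]
    rintro x ⟨U, hU, hxU⟩ ⟨V, hV, hxV⟩
    rcases hchain.total hU hV with hUV | hUV
    · exact Set.disjoint_left.1 (hc hV).2 (hUV hxU) hxV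
    · exact Set.disjoint_left.1 (hc hU).2 hxU (hUV hxV)
  obtain ⟨⟨hDo, hDd⟩, hmax⟩ := hD
  have hfD : IsOpen (f ⁻¹' D) := hDo.preimage hf
  have hdis := disjoint_closure_of_disjoint_isOpen hDd hDo hfD
  have hmaps : MapsTo f D (f ⁻¹' D) := fun x hx => by simpa [hff x] using hx
  have hmaps' : MapsTo f (f ⁻¹' D) D := fun x hx => hx
  -- `f` swaps the disjoint closures of `D` and `f ⁻¹' D`, so neither contains a fixed point; a
  -- moved point outside both would allow `D` to be enlarged.
  have hkey : {x | f x = x} = (closure (D ∪ f ⁻¹' D))ᶜ := by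
    ext x
    refine ⟨fun hx hcl => ?_, fun hx => ?_⟩
    · rw [closure_union] at hcl
      have hx' : f x = x := hx
      rcases hcl with h | h
      · exact Set.disjoint_left.1 hdis h (hx' ▸ hmaps.closure hf h)
      · exact Set.disjoint_left.1 hdis (hx' ▸ hmaps'.closure hf h) h
    · by_contra hne
      obtain ⟨P, Q, hP, hQ, hxP, hxQ, hPQ⟩ := t2_separation (show x ≠ f x from fun h => hne h.symm)
      set C := (closure (D ∪ f ⁻¹' D))ᶜ
      have hC : IsOpen C := isClosed_closure.isOpen_compl
      let W := C ∩ P ∩ f ⁻¹' Q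
      have hCD : ∀ y ∈ C, y ∉ D ∧ f y ∉ D := fun y hy =>
        ⟨fun h => hy (subset_closure (Or.inl h)), fun h => hy (subset_closure (Or.inr h))⟩
      have hW : D ∪ W ∈ {U : Set X | IsOpen U ∧ Disjoint U (f ⁻¹' U)} := by
        refine ⟨hDo.union ((hC.inter hP).inter (hQ.preimage hf)), Set.disjoint_left.2 ?_⟩
        rintro y (hy | ⟨⟨hyC, hyP⟩, hyQ⟩) (hy' | ⟨⟨hyC', hyP'⟩, hyQ'⟩)
        · exact Set.disjoint_left.1 hDd hy hy'
        · exact (hCD _ hyC').2 (by simpa [hff y] using hy)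
        · exact (hCD _ hyC).2 hy'
        · exact Set.disjoint_left.1 hPQ hyP' hyQ
      exact (hCD x hx).1 (hmax hW subset_union_left (Or.inr ⟨⟨hx, hxP⟩, hxQ⟩))
  rw [hkey]
  exact isClosed_closure.isOpen_compl

/-- A group with open set of involutions has an open Boolean subgroup. -/
theorem exists_isOpen_isBooleanSubgroup {G : Type*} [Group G] [TopologicalSpace G]
    [IsTopologicalGroup G] (h : IsOpen {x : G | x⁻¹ = x}) :
    ∃ H : Subgroup G, IsOpen (H : Set G) ∧ IsBooleanSubgroup H := by
  obtain ⟨V, hV, h1, hVV⟩ := exists_open_nhds_one_mul_subset (h.mem_nhds (x := 1) inv_one)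
  have hinv : ∀ x ∈ V, x⁻¹ = x := fun x hx => by
    simpa using hVV (Set.mul_mem_mul hx h1)
  have hcomm : ∀ x ∈ V, ∀ y ∈ V, x * y = y * x := fun x hx y hy => by
    have : (x * y)⁻¹ = x * y := hVV (Set.mul_mem_mul hx hy)
    rw [← this, mul_inv_rev, hinv x hx, hinv y hy]
  refine ⟨Subgroup.closure V, Subgroup.isOpen_of_mem_nhds _
    (mem_of_superset (hV.mem_nhds h1) Subgroup.subset_closure), fun x hx => ?_⟩
  have := Subgroup.isMulCommutative_closure hcomm
  have key : ∀ x hx, (⟨x, hx⟩ : Subgroup.closure V) * ⟨x, hx⟩ = 1 := by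
    intro x hx
    induction hx using Subgroup.closure_induction with
    | mem x hx => exact Subtype.ext (mul_eq_one_iff_eq_inv.2 (hinv x hx).symm)
    | one => exact mul_one _
    | mul x y hx hy ihx ihy =>
      have hyx : Commute (⟨y, hy⟩ : Subgroup.closure V) ⟨x, hx⟩ := this.is_comm.comm _ _
      exact (hyx.mul_mul_mul_comm _ _).trans (by rw [ihx, ihy, mul_one])
    | inv x hx ih =>
      have := congrArg Subtype.val ih
      refine Subtype.ext ?_
      change x⁻¹ * x⁻¹ = 1
      rw [← mul_inv_rev, inv_eq_one]
      exact this
  exact congrArg Subtype.val (key x hx)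

-- Countability via sunflowers

universe u

open Classical in
/-- A Boolean group is a group of finite sets with symmetric difference. -/
theorem exists_equiv_finset_of_mul_self {K : Type u} [Group K] (hK : ∀ x : K, x * x = 1) :
    ∃ (ι : Type u) (e : K ≃ Finset ι), ∀ x y, e (x * y) = symmDiff (e x) (e y) := by
  let _ : CommGroup K := { ‹Group K› with
    mul_comm := fun x y => by
      have h : ∀ z : K, z⁻¹ = z := fun z => inv_eq_of_mul_eq_one_left (hK z)
      rw [← h (x * y), mul_inv_rev, h, h] }
  let _ : Module (ZMod 2) (Additive K) := AddCommGroup.zmodModule fun x => by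
    rw [two_nsmul]
    exact hK x.toMul
  let b := Module.Basis.ofVectorSpace (ZMod 2) (Additive K)
  have hz : ∀ a b : ZMod 2, (a ≠ 0 ↔ b ≠ 0) → a = b := by decide
  have hz' : ∀ a b : ZMod 2, a + b ≠ 0 ↔ (a ≠ 0 ∧ ¬ b ≠ 0 ∨ b ≠ 0 ∧ ¬ a ≠ 0) := by decide
  let s : K → Finset (Module.Basis.ofVectorSpaceIndex (ZMod 2) (Additive K)) := fun x =>
    (b.repr (Additive.ofMul x)).support
  have hs : Function.Bijective s := by
    refine ⟨fun x y hxy => ?_, fun t => ?_⟩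
    · refine Additive.ofMul.injective (b.repr.injective (Finsupp.ext fun i => hz _ _ ?_))
      rw [← Finsupp.mem_support_iff, ← Finsupp.mem_support_iff]
      exact Finset.ext_iff.1 hxy i
    · refine ⟨(b.repr.symm (Finsupp.indicator t fun _ _ => 1)).toMul, ?_⟩
      ext i
      simp [s, Finsupp.indicator_apply]
  refine ⟨_, Equiv.ofBijective s hs, fun x y => ?_⟩
  ext i
  simp only [Equiv.ofBijective_apply, s, ofMul_mul, map_add, Finset.mem_symmDiff,
    Finsupp.mem_support_iff, Finsupp.add_apply]
  exact hz' _ _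

open Classical in
/-- Infinitely many sets of the same finite cardinality contain an infinite sunflower: they are
`r ∪ u` with a fixed kernel `r` and nonempty petals `u` of fixed size avoiding any finite set. -/
theorem Set.Infinite.exists_sunflower {ι : Type*} {F : Set (Finset ι)} (hF : F.Infinite) {n : ℕ}
    (hn : ∀ s ∈ F, s.card = n) :
    ∃ (r : Finset ι) (p : ℕ), 0 < p ∧ ∀ T : Finset ι, ∃ u : Finset ι,
      symmDiff r u ∈ F ∧ Disjoint u T ∧ u.card = p := by
  -- The kernel is a largest set contained in infinitely many members; by maximality, only finitely
  -- many of these contain a given point outside it.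
  let P : ℕ → Prop := fun k => ∃ r : Finset ι, r.card = k ∧ {s ∈ F | r ⊆ s}.Infinite
  have hP0 : P 0 := ⟨∅, rfl, by simpa using hF⟩
  have hPn : ∀ k, P k → k < n := by
    rintro k ⟨r, rfl, hr⟩
    by_contra! hle
    refine hr ((finite_singleton r).subset fun s hs => ?_)
    exact (Finset.eq_of_subset_of_card_le hs.2 ((hn s hs.1).trans_le hle)).symm
  obtain ⟨r, hrk, hr⟩ : P (Nat.findGreatest P n) := Nat.findGreatest_spec (Nat.zero_le n) hP0
  refine ⟨r, n - r.card, Nat.sub_pos_of_lt (hPn _ ⟨r, rfl, hr⟩), fun T => ?_⟩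
  have hfin : (⋃ t ∈ (T \ r : Finset ι), {s ∈ F | insert t r ⊆ s}).Finite := by
    refine (T \ r).finite_toSet.biUnion fun t ht => ?_
    by_contra hinf
    have ht' : t ∉ r := (Finset.mem_sdiff.1 ht).2
    have hP : P (r.card + 1) := ⟨insert t r, Finset.card_insert_of_notMem ht', hinf⟩
    have := Nat.le_findGreatest (hPn _ hP).le hP
    omega
  obtain ⟨s, ⟨hsF, hrs⟩, hs⟩ := (hr.sdiff hfin).nonempty
  refine ⟨s \ r, ?_, ?_, ?_⟩
  · convert hsF using 1
    ext i
    have := @hrs i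
    simp only [Finset.mem_symmDiff, Finset.mem_sdiff]
    tauto
  · rw [Finset.disjoint_left]
    intro t ht htT
    rw [Finset.mem_sdiff] at ht
    refine hs (mem_biUnion (x := t) (by simpa using ⟨htT, ht.2⟩) ⟨hsF, ?_⟩)
    exact Finset.insert_subset ht.1 hrs
  · rw [Finset.card_sdiff_of_subset hrs, hn s hsF]

theorem exists_nhds_one_pow_subset {G : Type*} [Monoid G] [TopologicalSpace G] [ContinuousMul G]
    (m : ℕ) {V : Set G} (hV : V ∈ 𝓝 (1 : G)) : ∃ W ∈ 𝓝 (1 : G), W ^ m ⊆ V := by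
  induction m generalizing V with
  | zero => exact ⟨V, hV, by simpa using mem_of_mem_nhds hV⟩
  | succ m ih =>
    obtain ⟨U, hU, h1, hUV⟩ := exists_open_nhds_one_mul_subset hV
    obtain ⟨W, hW, hWU⟩ := ih (hU.mem_nhds h1)
    refine ⟨W ∩ U, inter_mem hW (hU.mem_nhds h1), ?_⟩
    rw [pow_succ]
    exact (Set.mul_subset_mul ((Set.pow_subset_pow_left inter_subset_left).trans hWU)
      inter_subset_right).trans hUV

open Classical in
-- Some cardinality occurs infinitely often. In a product of two sunflower members the kernel
-- cancels, leaving two petals; `k` such products with disjoint petals are multiplied.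
theorem exists_mem_pow_of_not_countable {K ι : Type*} [Group K] (e : K ≃ Finset ι)
    (he : ∀ x y, e (x * y) = symmDiff (e x) (e y)) {W : Set K} (hW : ¬ W.Countable) :
    ∃ p : ℕ, 0 < p ∧ ∀ (k : ℕ) (T : Finset ι), ∃ v ∈ W ^ (2 * k),
      Disjoint (e v) T ∧ (e v).card = 2 * p * k := by
  obtain ⟨n, hn⟩ : ∃ n, {x ∈ W | (e x).card = n}.Infinite := by
    by_contra! hcon
    refine hW ((countable_iUnion fun n => (hcon n).countable).mono fun x hx => ?_)
    exact mem_iUnion.2 ⟨_, hx, rfl⟩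
  have he1 : e 1 = ∅ := by simpa using he 1 1
  obtain ⟨r, p, hp, hrp⟩ := (hn.image e.injective.injOn).exists_sunflower (n := n) <| by
    rintro _ ⟨x, hx, rfl⟩
    exact hx.2
  have hdisj : ∀ {s t : Finset ι}, Disjoint s t → symmDiff s t = s ∪ t := fun h =>
    h.symmDiff_eq_sup
  refine ⟨p, hp, fun k T => ?_⟩
  induction k with
  | zero => exact ⟨1, by simp, by simp [he1], by simp [he1]⟩
  | succ k ih =>
    obtain ⟨v, hv, hvT, hvc⟩ := ih
    obtain ⟨u₁, ⟨x₁, hx₁, hxu₁⟩, hd₁, hc₁⟩ := hrp (T ∪ e v)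
    obtain ⟨u₂, ⟨x₂, hx₂, hxu₂⟩, hd₂, hc₂⟩ := hrp (T ∪ e v ∪ u₁)
    rw [Finset.disjoint_union_right] at hd₁ hd₂
    rw [Finset.disjoint_union_right] at hd₂
    have hu : e (x₁ * x₂) = u₁ ∪ u₂ := by
      rw [he, hxu₁, hxu₂, symmDiff_comm r u₁, symmDiff_assoc, symmDiff_symmDiff_cancel_left,
        hdisj hd₂.2.symm]
    have hvu : Disjoint (e v) (u₁ ∪ u₂) :=
      Finset.disjoint_union_right.2 ⟨hd₁.2.symm, hd₂.1.2.symm⟩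
    refine ⟨v * (x₁ * x₂), ?_, ?_, ?_⟩
    · rw [mul_add, mul_one, pow_add, pow_two]
      exact mul_mem_mul hv (mul_mem_mul hx₁.1 hx₂.1)
    · rw [he, hu, hdisj hvu, Finset.disjoint_union_left, Finset.disjoint_union_left]
      exact ⟨hvT, hd₁.1, hd₂.1.1⟩
    · rw [he, hu, hdisj hvu, Finset.card_union_of_disjoint hvu,
        Finset.card_union_of_disjoint hd₂.2.symm, hvc, hc₁, hc₂]
      ring

theorem Nat.log_two_mul_pow_add {a b c : ℕ} (hb : b ≠ 0) (hc : c < 2 ^ a) :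
    Nat.log 2 (b * 2 ^ a + c) = Nat.log 2 b + a := by
  refine Nat.log_eq_of_pow_le_of_lt_pow ?_ ?_
  · rw [pow_add]
    exact (Nat.mul_le_mul_right _ (Nat.pow_log_le_self 2 hb)).trans (Nat.le_add_right _ _)
  · have : b + 1 ≤ 2 ^ (Nat.log 2 b + 1) := Nat.lt_pow_succ_log_self one_lt_two b
    calc b * 2 ^ a + c < (b + 1) * 2 ^ a := by rw [add_mul, one_mul]; omega
      _ ≤ 2 ^ (Nat.log 2 b + 1) * 2 ^ a := Nat.mul_le_mul_right _ this
      _ = 2 ^ (Nat.log 2 b + a + 1) := by ring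

open Classical in
/-- A Boolean topological group all of whose neighbourhoods of the identity are uncountable is
resolvable. -/
theorem exists_dense_dense_compl {K : Type*} [Group K] [TopologicalSpace K] [IsTopologicalGroup K]
    (hK : ∀ x : K, x * x = 1) (hunc : ∀ V ∈ 𝓝 (1 : K), ¬ V.Countable) :
    ∃ A : Set K, Dense A ∧ Dense Aᶜ := by
  obtain ⟨ι, e, he⟩ := exists_equiv_finset_of_mul_self hK
  have key : ∀ (x : K) (U : Set K), IsOpen U → x ∈ U → ∃ m : ℕ,
      (∃ y ∈ U, Nat.log 2 (e y).card = m) ∧ ∃ y ∈ U, Nat.log 2 (e y).card = m + 1 := by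
    intro x U hU hx
    set a := (e x).card
    have ha : a < 2 ^ a := Nat.lt_two_pow_self
    have hV : (fun v => x * v) ⁻¹' U ∈ 𝓝 (1 : K) :=
      (hU.preimage (continuous_const_mul x)).mem_nhds (by simpa using hx)
    -- The exponent serves both `b = a` and `b = a + 1`. Multiplying `x` by a disjoint `v` of size
    -- `2 * p * 2 ^ b` gives consecutive logarithms, hence both parities.
    obtain ⟨W, hW, hWV⟩ := exists_nhds_one_pow_subset (2 * 2 ^ (a + 1)) hV
    obtain ⟨p, hp, hpk⟩ := exists_mem_pow_of_not_countable e he (hunc W hW)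
    have main : ∀ b, a ≤ b → b ≤ a + 1 →
        ∃ y ∈ U, Nat.log 2 (e y).card = Nat.log 2 (2 * p) + b := by
      intro b hab hba
      obtain ⟨v, hv, hvx, hvc⟩ := hpk (2 ^ b) (e x)
      refine ⟨x * v, hWV (Set.pow_subset_pow_right (mem_of_mem_nhds hW)
        (Nat.mul_le_mul_left 2 (Nat.pow_le_pow_right two_pos hba)) hv), ?_⟩
      rw [he, hvx.symm.symmDiff_eq_sup, Finset.sup_eq_union, Finset.card_union_of_disjoint hvx.symm,
        hvc, add_comm]
      exact Nat.log_two_mul_pow_add (by omega) (ha.trans_le (Nat.pow_le_pow_right two_pos hab))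
    exact ⟨_, main a le_rfl (Nat.le_succ a), main (a + 1) (Nat.le_succ a) le_rfl⟩
  refine ⟨{y | Even (Nat.log 2 (e y).card)}, dense_iff_inter_open.2 ?_, dense_iff_inter_open.2 ?_⟩
  all_goals
    rintro U hU ⟨x, hx⟩
    obtain ⟨m, ⟨y, hy, hym⟩, z, hz, hzm⟩ := key x U hU hx
    rcases Nat.even_or_odd m with hm | hm
  · exact ⟨y, hy, by simpa [hym] using hm⟩
  · exact ⟨z, hz, by simpa [hzm] using hm.add_one⟩
  · exact ⟨z, hz, by simpa [hzm] using hm.add_one⟩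
  · exact ⟨y, hy, by simpa [hym] using hm⟩

theorem IsMaximalSpace.exists_countable_mem_nhds_one {K : Type*} [Group K] [TopologicalSpace K]
    [IsTopologicalGroup K] [T1Space K] (h : IsMaximalSpace K) (hK : ∀ x : K, x * x = 1) :
    ∃ V ∈ 𝓝 (1 : K), V.Countable := by
  by_contra! hunc
  obtain ⟨A, hA, hA'⟩ := exists_dense_dense_compl hK hunc
  obtain ⟨x, hx, hx'⟩ := hA'.inter_open_nonempty A (h.isOpen_of_dense hA) hA.nonempty
  exact hx' hx

/-! ### Closed suitable sets in maximal Boolean groups -/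

/-- A maximal Boolean group has a basis that is a closed discrete set. -/
theorem IsMaximalSpace.exists_isClosedSuitableSet {K : Type*} [Group K] [TopologicalSpace K]
    [IsTopologicalGroup K] [T1Space K] (h : IsMaximalSpace K) (hK : ∀ x : K, x * x = 1) :
    ∃ S : Set K, IsClosedSuitableSet S := by
  classical
  obtain ⟨ι, e, he⟩ := exists_equiv_finset_of_mul_self hK
  have he1 : e 1 = ∅ := by simpa using he 1 1
  let S : Set K := {x | (e x).card = 1}
  have hint : interior S = ∅ := by
    by_contra! hne
    obtain ⟨x, hx⟩ := hne
    have hV : (fun v => x * v) ⁻¹' interior S ∈ 𝓝 (1 : K) :=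
      (isOpen_interior.preimage (continuous_const_mul x)).mem_nhds (by simpa using hx)
    obtain ⟨W, hWo, h1W, hWV⟩ := exists_open_nhds_one_mul_subset hV
    have hWS : ∀ v ∈ W, ∀ w ∈ W, x * (v * w) ∈ S := fun v hv w hw =>
      interior_subset (hWV (mul_mem_mul hv hw))
    have := h.perfectSpace
    have hWp := preperfect_iff_nhds.1 (hWo.preperfect)
    obtain ⟨v, ⟨-, hvW⟩, hv⟩ := hWp 1 h1W _ univ_mem
    obtain ⟨w, ⟨hwv, hwW⟩, hw⟩ := hWp 1 h1W {v}ᶜ (isOpen_ne.mem_nhds hv.symm)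
    obtain ⟨a, ha⟩ := Finset.card_eq_one.1 (interior_subset hx : x ∈ S)
    obtain ⟨b, hb⟩ := Finset.card_eq_one.1 (hWS v hvW 1 h1W)
    obtain ⟨c, hc⟩ := Finset.card_eq_one.1 (hWS w hwW 1 h1W)
    obtain ⟨d, hd⟩ := Finset.card_eq_one.1 (hWS v hvW w hwW)
    rw [mul_one] at hb hc
    have hab : a ≠ b := by
      rintro rfl
      exact hv (by simpa using e.injective (hb.trans ha.symm))
    have hac : a ≠ c := by
      rintro rfl
      exact hw (by simpa using e.injective (hc.trans ha.symm))
    have hbc : b ≠ c := by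
      rintro rfl
      exact hwv (by simpa using e.injective (hc.trans hb.symm))
    -- Both sides code `v * w`; since `b ≠ c`, this forces `a` to be `b` or `c`.
    have hsum : symmDiff {b} {c} = (symmDiff {a} {d} : Finset ι) := by
      rw [← ha, ← hb, ← hc, ← hd]
      simp only [he]
      rw [symmDiff_symmDiff_cancel_left, symmDiff_symmDiff_symmDiff_comm, symmDiff_self,
        bot_symmDiff]
    have h1 := Finset.ext_iff.1 hsum b
    have h2 := Finset.ext_iff.1 hsum c
    simp only [Finset.mem_symmDiff, Finset.mem_singleton] at h1 h2
    grind
  -- The complement of `T` is dense, hence open.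
  have hcl : ∀ T ⊆ S, IsClosed T := fun T hT => by
    rw [← isOpen_compl_iff]
    exact h.isOpen_of_dense (interior_eq_empty_iff_dense_compl.1
      (subset_empty_iff.1 (hint ▸ interior_mono hT)))
  have hS : IsClosed S := hcl S Subset.rfl
  refine ⟨S, ⟨?_, hS.union isClosed_singleton, ?_⟩, hS⟩
  · refine discreteTopology_iff_forall_isClosed.2 fun T => ?_
    rw [← preimage_image_eq T Subtype.val_injective]
    exact (hcl _ (Subtype.coe_image_subset S T)).preimage continuous_subtype_val
  · have : ∀ s : Finset ι, e.symm s ∈ Subgroup.closure S := by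
      intro s
      induction s using Finset.induction_on with
      | empty => rw [← he1, e.symm_apply_apply]; exact one_mem _
      | insert a s has ih =>
        have hS' : e.symm {a} ∈ S := by simp [S]
        have : e.symm (insert a s) = e.symm {a} * e.symm s := by
          rw [Equiv.symm_apply_eq, he, e.apply_symm_apply, e.apply_symm_apply,
            (Finset.disjoint_singleton_left.2 has).symmDiff_eq_sup]
          rfl
        rw [this]
        exact mul_mem (Subgroup.subset_closure hS') ih
    have htop : (Subgroup.closure S : Set K) = univ := eq_univ_of_forall fun x => by
      simpa using this (e x)
    rw [htop]
    exact dense_univ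

/-! ### Passage from `H` to `G` -/

theorem IsMaximalSpace.exists_countable_isBooleanSubgroup {G : Type*} [Group G]
    [TopologicalSpace G] [IsTopologicalGroup G] [T2Space G] (hG : IsMaximalSpace G) :
    ∃ H : Subgroup G, IsOpen (H : Set G) ∧ (H : Set G).Countable ∧ IsBooleanSubgroup H := by
  have := hG.extremallyDisconnected
  obtain ⟨B, hBo, hB⟩ := exists_isOpen_isBooleanSubgroup
    (ExtremallyDisconnected.isOpen_fixedPoints (X := G) continuous_inv inv_involutive)
  obtain ⟨V, hV, hVc⟩ := IsMaximalSpace.exists_countable_mem_nhds_one (K := B)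
    (hG.subtype hBo) fun x => Subtype.ext (hB x x.2)
  have hV' : Subtype.val '' V ∈ 𝓝 (1 : G) := hBo.isOpenMap_subtype_val.image_mem_nhds hV
  refine ⟨Subgroup.closure (Subtype.val '' V), Subgroup.isOpen_of_mem_nhds _
    (mem_of_superset hV' Subgroup.subset_closure), ?_, fun x hx => hB x ?_⟩
  · have := (hVc.image (Subtype.val : B → G)).to_subtype
    rw [FreeGroup.closure_eq_range, MonoidHom.coe_range]
    exact countable_range _
  · refine (Subgroup.closure_le B).2 ?_ hx
    rintro _ ⟨y, -, rfl⟩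
    exact y.2

theorem Subgroup.exists_selectsOutsideCosets {G : Type*} [Group G] (H : Subgroup G) :
    ∃ A : Set G, SelectsOutsideCosets H A := by
  refine ⟨{a | a ∉ H ∧ ((a : G ⧸ H)).out = a}, fun a ha => ha.1, fun g hg => ?_⟩
  have hout : ((g : G ⧸ H).out)⁻¹ * g ∈ H := QuotientGroup.eq.1 (QuotientGroup.out_eq' _)
  refine ⟨(g : G ⧸ H).out, ⟨⟨fun h => hg ?_, ?_⟩, hout⟩, ?_⟩
  · simpa using mul_mem h hout
  · rw [QuotientGroup.out_eq']
  · rintro a ⟨⟨-, ha⟩, hag⟩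
    rw [← ha, QuotientGroup.eq.2 hag]

theorem IsClosedSuitableSet.union_of_selectsOutsideCosets {G : Type*} [Group G]
    [TopologicalSpace G] [IsTopologicalGroup G] [T1Space G] {H : Subgroup G}
    (hH : IsOpen (H : Set G)) {S : Set H} (hS : IsClosedSuitableSet S) {A : Set G}
    (hA : SelectsOutsideCosets H A) : IsClosedSuitableSet (A ∪ Subtype.val '' S) := by
  have hHc : IsClosed (H : Set G) := H.isClosed_of_isOpen hH
  have hSd := isClosed_and_discrete_iff.1 ⟨hS.isClosed, ⟨hS.isSuitable.discrete⟩⟩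
  have hloc : ∀ x, Disjoint (𝓝[≠] x) (𝓟 (A ∪ Subtype.val '' S)) := by
    intro x
    rw [disjoint_principal_right, mem_nhdsWithin]
    by_cases hx : x ∈ H
    · have := hSd ⟨x, hx⟩
      rw [disjoint_principal_right, mem_nhdsWithin] at this
      obtain ⟨U, hU, hxU, hUS⟩ := this
      refine ⟨Subtype.val '' U, hH.isOpenMap_subtype_val U hU, ⟨_, hxU, rfl⟩, ?_⟩
      rintro _ ⟨⟨y, hy, rfl⟩, hyx⟩ (hyA | ⟨z, hz, hzy⟩)
      · exact hA.1 _ hyA y.2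
      · obtain rfl : z = y := Subtype.ext hzy
        exact hUS ⟨hy, fun h => hyx (congrArg Subtype.val h)⟩ hz
    · obtain ⟨a, ⟨haA, hax⟩, huniq⟩ := hA.2 x hx
      -- The coset of `x` meets the set only in `a`, which is removed unless it is `x` itself.
      refine ⟨{y | x⁻¹ * y ∈ H} ∩ ({a} \ {x})ᶜ, (hH.preimage (continuous_const_mul _)).inter
        (((finite_singleton a).subset sdiff_subset).isClosed.isOpen_compl), ⟨by simp, by simp⟩, ?_⟩
      rintro y ⟨⟨hy, hya⟩, hyx⟩ (hyA | ⟨z, hz, rfl⟩)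
      · refine hya ⟨huniq y ⟨hyA, ?_⟩, hyx⟩
        simpa using H.inv_mem hy
      · refine hx ?_
        have : x⁻¹ ∈ H := (H.mul_mem_cancel_right z.2).1 hy
        exact H.inv_mem_iff.1 this
  obtain ⟨hcl, hdisc⟩ := isClosed_and_discrete_iff.2 hloc
  refine ⟨⟨hdisc.to_subtype, hcl.union isClosed_singleton, ?_⟩, hcl⟩
  let C := (Subgroup.closure (A ∪ Subtype.val '' S)).topologicalClosure
  have hsub : A ∪ Subtype.val '' S ⊆ C :=
    Subgroup.subset_closure.trans (Subgroup.le_topologicalClosure _)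
  have hHC : H ≤ C := by
    intro x hx
    have hmaps : MapsTo (Subtype.val : H → G) (Subgroup.closure S)
        (Subgroup.closure (A ∪ Subtype.val '' S)) := by
      intro y hy
      have : Subgroup.closure S ≤ (Subgroup.closure (A ∪ Subtype.val '' S)).comap H.subtype :=
        (Subgroup.closure_le _).2 fun z hz => Subgroup.subset_closure (Or.inr ⟨z, hz, rfl⟩)
      exact this hy
    exact hmaps.closure continuous_subtype_val (hS.isSuitable.dense ⟨x, hx⟩)
  intro g
  change g ∈ C
  by_cases hg : g ∈ H
  · exact hHC hg
  · obtain ⟨a, ⟨haA, hag⟩, -⟩ := hA.2 g hg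
    simpa using mul_mem (hsub (Or.inl haA)) (hHC hag)

theorem mainTheorem9 {G : Type*} [Group G] [TopologicalSpace G] [IsTopologicalGroup G]
    [T2Space G] (hG : IsMaximalSpace G) :
    (∃ S : Set G, IsClosedSuitableSet S) ∧
    ∃ H : Subgroup G, IsOpen (H : Set G) ∧ (H : Set G).Countable ∧ IsBooleanSubgroup H ∧
      (∃ S : Set H, IsClosedSuitableSet S) ∧
      ∀ S : Set H, IsClosedSuitableSet S → ∀ A : Set G, SelectsOutsideCosets H A →
        IsClosedSuitableSet (A ∪ Subtype.val '' S) := by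
  obtain ⟨H, hHo, hHc, hHb⟩ := hG.exists_countable_isBooleanSubgroup
  obtain ⟨S, hS⟩ := IsMaximalSpace.exists_isClosedSuitableSet (K := H) (hG.subtype hHo)
    fun x => Subtype.ext (hHb x x.2)
  obtain ⟨A, hA⟩ := H.exists_selectsOutsideCosets
  exact ⟨⟨_, hS.union_of_selectsOutsideCosets hHo hA⟩, H, hHo, hHc, hHb, ⟨S, hS⟩,
    fun S hS A hA => hS.union_of_selectsOutsideCosets hHo hA⟩
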